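/- Let $(X,d)$ be a proper, non-compact $\mathrm{CAT}(-1)$ space and let $\Gamma$ be a discrete (for the compact-open topology), cocompact subgroup of the group of isometries of $X$. Equip $X\times X$ with the maximum metric $d_{\max}((x,y),(x',y'))=\max\{d(x,x'),d(y,y')\}$. Let $C_*$ be the space of continuous functions $X\times X\to\mathbb{R}$ with the topology of uniform convergence on compact sets, modulo additive constants, embed $X\times X$ in $C_*$ by $\iota(p)=[d_{\max}(p,\cdot)]$, and let $\partial_\infty^{\max}(X\times X)=\overline{\iota(X\times X)}\setminus\iota(X\times X)$ be the horofunction boundary. The diagonal action of $\Gamma$ on $X\times X$ extends to $\partial_\infty^{\max}(X\times X)$ by $\gamma\cdot[h]=[h\circ\gamma^{-1}]$. For a geodesic ray $c:[0,\infty)\to X$ (an isometric embedding) let $\beta_c(z)=\lim_{t\to\infty}\bigl(d(z,c(t))-t\bigr)$ be its Busemann function and let $c(\infty)\in\partial_\infty X$ be its ideal endpoint, where two rays $c,c'$ have the same endpoint if and only if $d(c(t),c'(t))$ is bounded in $t$. Let $\Omega\subset\partial_\infty^{\max}(X\times X)$ be the $\Gamma$-invariant set of all boundary points represented by a function of the form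 $$(z,z')\mapsto\max\{\beta_c(z),\ \beta_{c'}(z')+C\},$$ where $C\in\mathbb{R}$ and $c,c'$ are rays in $X$ with $c(\infty)\neq c'(\infty)$, with the subspace topology. Then the action of $\Gamma$ on $\Omega$ is cocompact (there is a compact set $K\subset\Omega$ with $\Gamma K=\Omega$) and properly discontinuous (for all compact $K,L\subset\Omega$ the set $\gamma K\cap L$ is non-empty for only finitely many $\gamma\in\Gamma$). -/

import Mathlib

open Set Filter Topology

/-! ### `CAT(-1)` spaces -/

/-- `c`, restricted to `[0, d(p,q)]`, is a geodesic segment from `p` to `q`. -/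
structure IsGeodesicSegment {X : Type*} [MetricSpace X] (c : ℝ → X) (p q : X) : Prop where
  map_zero : c 0 = p
  map_dist : c (dist p q) = q
  dist_eq : ∀ s ∈ Icc (0 : ℝ) (dist p q), ∀ t ∈ Icc (0 : ℝ) (dist p q),
    dist (c s) (c t) = |s - t|

/-- `X` is a `CAT(-1)` space: a geodesic space whose geodesic triangles are at least as thin as
their comparison triangles in the hyperbolic plane (the upper half-plane, of curvature `-1`).
Two points on the same side of a triangle are at the same distance as their comparison points, so
only points on two different sides have to be compared; the common vertex of the two sides is
called `p`. -/
structure IsCATNegOne (X : Type*) [MetricSpace X] : Prop where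
  exists_segment : ∀ p q : X, ∃ c : ℝ → X, IsGeodesicSegment c p q
  comparison : ∀ (p q r : X) (c c' : ℝ → X),
    IsGeodesicSegment c p q → IsGeodesicSegment c' p r →
    ∀ (p₀ q₀ r₀ : UpperHalfPlane) (k k' : ℝ → UpperHalfPlane),
      dist p₀ q₀ = dist p q → dist p₀ r₀ = dist p r → dist q₀ r₀ = dist q r →
      IsGeodesicSegment k p₀ q₀ → IsGeodesicSegment k' p₀ r₀ →
      ∀ s ∈ Icc (0 : ℝ) (dist p q), ∀ t ∈ Icc (0 : ℝ) (dist p r),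
        dist (c s) (c' t) ≤ dist (k s) (k' t)

/-! ### Groups of isometries -/

/-- The isometry group of `X` acts on `X` by evaluation. -/
instance isometryEquivMulAction {X : Type*} [MetricSpace X] : MulAction (X ≃ᵢ X) X where
  smul γ x := γ x
  one_smul _ := rfl
  mul_smul _ _ _ := rfl

instance isometryEquivIsIsometricSMul {X : Type*} [MetricSpace X] :
    IsIsometricSMul (X ≃ᵢ X) X :=
  ⟨fun γ => γ.isometry⟩

/-- `Γ` is a discrete subgroup of the isometry group, the latter with the compact-open topology. -/
def IsDiscreteSubgroup {X : Type*} [MetricSpace X] (Γ : Subgroup (X ≃ᵢ X)) : Prop :=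
  @DiscreteTopology Γ (TopologicalSpace.induced
    (fun γ : Γ => (⟨fun x => (γ : X ≃ᵢ X) x, (γ : X ≃ᵢ X).continuous⟩ : C(X, X))) inferInstance)

/-- The action of `Γ` on `T` is cocompact: the translates of some compact set cover `T`. -/
def IsCocompactAction (Γ T : Type*) [TopologicalSpace T] [SMul Γ T] : Prop :=
  ∃ K : Set T, IsCompact K ∧ ∀ x : T, ∃ γ : Γ, ∃ y ∈ K, γ • y = x

/-! ### Rays and Busemann functions -/

/-- A geodesic ray: an isometric embedding of `[0, ∞)`. -/
structure GeodesicRay (X : Type*) [MetricSpace X] where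
  toFun : NNReal → X
  isometry_toFun : Isometry toFun

instance geodesicRayCoeFun {X : Type*} [MetricSpace X] :
    CoeFun (GeodesicRay X) (fun _ => NNReal → X) :=
  ⟨GeodesicRay.toFun⟩

/-- Two rays are asymptotic if they stay at bounded distance. -/
instance geodesicRaySetoid (X : Type*) [MetricSpace X] : Setoid (GeodesicRay X) where
  r c c' := ∃ C : ℝ, ∀ t : NNReal, dist (c t) (c' t) ≤ C
  iseqv :=
    { refl := fun c => ⟨0, fun t => by simp⟩
      symm := fun ⟨C, h⟩ => ⟨C, fun t => by rw [dist_comm]; exact h t⟩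
      trans := fun ⟨C, h⟩ ⟨C', h'⟩ =>
        ⟨C + C', fun t => (dist_triangle _ _ _).trans (add_le_add (h t) (h' t))⟩ }

/-- The ideal boundary of `X`: asymptote classes of rays. -/
def RayBoundary (X : Type*) [MetricSpace X] : Type _ := Quotient (geodesicRaySetoid X)

/-- The ideal endpoint of a ray. -/
def GeodesicRay.endpoint {X : Type*} [MetricSpace X] (c : GeodesicRay X) : RayBoundary X :=
  Quotient.mk (geodesicRaySetoid X) c

/-- The Busemann function `x ↦ lim_{t → ∞} d(x, c(t)) - t` of a ray `c`. -/
noncomputable def busemann {X : Type*} [MetricSpace X] (c : GeodesicRay X) (x : X) : ℝ :=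
  limUnder atTop (fun t : NNReal => dist x (c t) - (t : ℝ))

theorem tendsto_busemann {X : Type*} [MetricSpace X] (c : GeodesicRay X) (x : X) :
    Tendsto (fun t : NNReal => dist x (c t) - (t : ℝ)) atTop (𝓝 (busemann c x)) := by
  have key : ∀ s t : NNReal, dist (c s) (c t) = |(s : ℝ) - t| := fun s t => by
    rw [c.isometry_toFun.dist_eq, NNReal.dist_eq]
  have hanti : Antitone (fun t : NNReal => dist x (c t) - (t : ℝ)) := by
    intro s t hst
    have h1 := dist_triangle x (c s) (c t)
    have h2 : (s : ℝ) ≤ t := by exact_mod_cast hst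
    rw [key, abs_sub_comm, abs_of_nonneg (by linarith)] at h1
    show dist x (c t) - (t : ℝ) ≤ dist x (c s) - (s : ℝ)
    linarith
  have hbdd : BddBelow (range (fun t : NNReal => dist x (c t) - (t : ℝ))) := by
    refine ⟨-dist (c 0) x, ?_⟩
    rintro _ ⟨t, rfl⟩
    have h1 := dist_triangle (c 0) x (c t)
    rw [key, abs_sub_comm] at h1
    simp only [NNReal.coe_zero, sub_zero, NNReal.abs_eq] at h1
    show -dist (c 0) x ≤ dist x (c t) - (t : ℝ)
    linarith
  exact tendsto_nhds_limUnder ⟨_, tendsto_atTop_ciInf hanti hbdd⟩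

theorem continuous_busemann {X : Type*} [MetricSpace X] (c : GeodesicRay X) :
    Continuous (busemann c) := by
  have hle : ∀ x y : X, busemann c x ≤ busemann c y + dist x y := fun x y =>
    le_of_tendsto_of_tendsto' (tendsto_busemann c x) ((tendsto_busemann c y).add_const _)
      (fun t => by linarith [dist_triangle x y (c t)])
  exact (LipschitzWith.of_le_add hle).continuous

/-! ### The horofunction boundary -/

/-- The constant functions. -/
def constFunctions (Y : Type*) [TopologicalSpace Y] : AddSubgroup C(Y, ℝ) where
  carrier := {f | ∃ a : ℝ, ∀ y, f y = a}
  zero_mem' := ⟨0, fun _ => rfl⟩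
  add_mem' := fun ⟨a, ha⟩ ⟨b, hb⟩ => ⟨a + b, fun y => by simp [ha y, hb y]⟩
  neg_mem' := fun ⟨a, ha⟩ => ⟨-a, fun y => by simp [ha y]⟩

/-- The space `C_*` of continuous real functions, with the topology of uniform convergence on
compact sets, modulo additive constants (with the quotient topology). -/
def FunModConst (Y : Type*) [TopologicalSpace Y] : Type _ := C(Y, ℝ) ⧸ constFunctions Y

instance funModConstTopologicalSpace (Y : Type*) [TopologicalSpace Y] :
    TopologicalSpace (FunModConst Y) :=
  inferInstanceAs (TopologicalSpace (C(Y, ℝ) ⧸ constFunctions Y))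

/-- The class of a function modulo constants. -/
def FunModConst.mk {Y : Type*} [TopologicalSpace Y] (f : C(Y, ℝ)) : FunModConst Y :=
  QuotientAddGroup.mk f

theorem FunModConst.mk_eq_mk {Y : Type*} [TopologicalSpace Y] {f g : C(Y, ℝ)} :
    FunModConst.mk f = FunModConst.mk g ↔ ∃ a : ℝ, ∀ y, g y = f y + a := by
  refine QuotientAddGroup.eq.trans ⟨?_, ?_⟩
  · rintro ⟨a, ha⟩
    refine ⟨a, fun y => ?_⟩
    have h : -f y + g y = a := ha y
    linarith
  · rintro ⟨a, ha⟩
    refine ⟨a, fun y => ?_⟩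
    show -f y + g y = a
    rw [ha y]
    ring

/-- The embedding `p ↦ [d(p, ·)]`. -/
noncomputable def distClass {Y : Type*} [MetricSpace Y] (p : Y) : FunModConst Y :=
  FunModConst.mk ⟨fun y => dist p y, continuous_const.dist continuous_id⟩

/-- The horofunction boundary of a metric space. -/
def horofunctionBoundary (Y : Type*) [MetricSpace Y] : Set (FunModConst Y) :=
  closure (range (distClass (Y := Y))) \ range (distClass (Y := Y))

/-- The action on classes of functions induced by an action on the space:
`γ • [f] = [f ∘ γ⁻¹]`. It extends the action on the space, since `γ • [d(p, ·)] = [d(γ p, ·)]`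
for isometries `γ`. -/
instance funModConstMulAction {G Y : Type*} [Group G] [TopologicalSpace Y] [MulAction G Y]
    [ContinuousConstSMul G Y] : MulAction G (FunModConst Y) where
  smul γ := Quotient.lift
    (fun f : C(Y, ℝ) => FunModConst.mk (f.comp ⟨fun y => γ⁻¹ • y, continuous_const_smul _⟩))
    (fun f g h => by
      obtain ⟨a, ha⟩ := FunModConst.mk_eq_mk.1 (Quotient.sound h)
      exact FunModConst.mk_eq_mk.2 ⟨a, fun y => ha _⟩)
  one_smul := by
    rintro ⟨f⟩
    exact FunModConst.mk_eq_mk.2 ⟨0, fun y => by simp⟩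
  mul_smul γ γ' := by
    rintro ⟨f⟩
    exact FunModConst.mk_eq_mk.2 ⟨0, fun y => by simp [mul_smul]⟩

theorem FunModConst.smul_mk {G Y : Type*} [Group G] [TopologicalSpace Y] [MulAction G Y]
    [ContinuousConstSMul G Y] (γ : G) (f : C(Y, ℝ)) :
    γ • FunModConst.mk f =
      FunModConst.mk (f.comp ⟨fun y => γ⁻¹ • y, continuous_const_smul _⟩) := rfl

instance funModConstContinuousConstSMul {G Y : Type*} [Group G] [TopologicalSpace Y]
    [MulAction G Y] [ContinuousConstSMul G Y] : ContinuousConstSMul G (FunModConst Y) where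
  continuous_const_smul _ :=
    Continuous.quotient_lift
      (continuous_quotient_mk'.comp (ContinuousMap.continuous_precomp _)) _

theorem smul_distClass {G Y : Type*} [Group G] [MetricSpace Y] [MulAction G Y]
    [IsIsometricSMul G Y] (γ : G) (p : Y) : γ • distClass p = distClass (γ • p) := by
  refine FunModConst.mk_eq_mk.2 ⟨0, fun y => ?_⟩
  show dist (γ • p) y = dist p (γ⁻¹ • y) + 0
  rw [add_zero, ← dist_smul γ p, smul_inv_smul]

theorem smul_mem_horofunctionBoundary {G Y : Type*} [Group G] [MetricSpace Y] [MulAction G Y]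
    [IsIsometricSMul G Y] (γ : G) {η : FunModConst Y} (h : η ∈ horofunctionBoundary Y) :
    γ • η ∈ horofunctionBoundary Y := by
  refine ⟨?_, ?_⟩
  · refine map_mem_closure (continuous_const_smul γ) h.1 ?_
    rintro _ ⟨p, rfl⟩
    exact ⟨γ • p, (smul_distClass γ p).symm⟩
  · rintro ⟨p, hp⟩
    refine h.2 ⟨γ⁻¹ • p, ?_⟩
    rw [← smul_distClass, hp, inv_smul_smul]

/-! ### The ideal domain -/

/-- The function `(z, z') ↦ max {β_c(z), β_{c'}(z') + C}` on `X × X`. -/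
noncomputable def maxBusemann {X : Type*} [MetricSpace X] (c c' : GeodesicRay X) (C : ℝ) :
    C(X × X, ℝ) where
  toFun z := max (busemann c z.1) (busemann c' z.2 + C)
  continuous_toFun :=
    ((continuous_busemann c).comp continuous_fst).max
      (((continuous_busemann c').comp continuous_snd).add continuous_const)

/-- The ideal domain `Ω`: the points of the horofunction boundary of `X × X`, for the maximum
metric (which is the metric of `X × X` in Mathlib), that have a representative
`max {β_ξ(z), β_{ξ'}(z') + C}` with `ξ ≠ ξ'`. -/
def idealDomain (X : Type*) [MetricSpace X] : Set (FunModConst (X × X)) :=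
  {η ∈ horofunctionBoundary (X × X) | ∃ (c c' : GeodesicRay X) (C : ℝ),
    c.endpoint ≠ c'.endpoint ∧ η = FunModConst.mk (maxBusemann c c' C)}

/-- The image of a ray under an isometry. -/
def GeodesicRay.map {X : Type*} [MetricSpace X] (γ : X ≃ᵢ X) (c : GeodesicRay X) :
    GeodesicRay X :=
  ⟨fun t => γ (c t), γ.isometry.comp c.isometry_toFun⟩

theorem busemann_map {X : Type*} [MetricSpace X] (γ : X ≃ᵢ X) (c : GeodesicRay X) (x : X) :
    busemann (c.map γ) x = busemann c (γ⁻¹ • x) := by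
  refine tendsto_nhds_unique (tendsto_busemann (c.map γ) x) ?_
  refine (tendsto_busemann c (γ⁻¹ • x)).congr fun t => ?_
  show dist (γ⁻¹ • x) (c t) - (t : ℝ) = dist x (γ • c t) - (t : ℝ)
  rw [← dist_smul γ (γ⁻¹ • x), smul_inv_smul]

theorem GeodesicRay.endpoint_map_ne {X : Type*} [MetricSpace X] (γ : X ≃ᵢ X)
    {c c' : GeodesicRay X} (h : c.endpoint ≠ c'.endpoint) :
    (c.map γ).endpoint ≠ (c'.map γ).endpoint := by
  intro h'
  obtain ⟨C, hC⟩ := Quotient.exact h'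
  exact h (Quotient.sound ⟨C, fun t => by
    have := hC t
    rwa [show dist ((c.map γ) t) ((c'.map γ) t) = dist (c t) (c' t) from
      γ.isometry.dist_eq _ _] at this⟩)

theorem smul_mem_idealDomain {X : Type*} [MetricSpace X] (γ : X ≃ᵢ X)
    {η : FunModConst (X × X)} (h : η ∈ idealDomain X) : γ • η ∈ idealDomain X := by
  obtain ⟨hη, c, c', C, hne, rfl⟩ := h
  refine ⟨smul_mem_horofunctionBoundary γ hη, c.map γ, c'.map γ, C,
    GeodesicRay.endpoint_map_ne γ hne, ?_⟩
  refine FunModConst.mk_eq_mk.2 ⟨0, fun z => ?_⟩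
  show max (busemann (c.map γ) z.1) (busemann (c'.map γ) z.2 + C) =
    max (busemann c (γ⁻¹ • z).1) (busemann c' (γ⁻¹ • z).2 + C) + 0
  rw [busemann_map, busemann_map, add_zero]
  rfl

/-- The action of the isometry group (hence of its subgroups) on the ideal domain, induced by the
diagonal action on `X × X`. -/
instance idealDomainMulAction {X : Type*} [MetricSpace X] :
    MulAction (X ≃ᵢ X) (idealDomain X) where
  smul γ η := ⟨γ • (η : FunModConst (X × X)), smul_mem_idealDomain γ η.2⟩
  one_smul η := Subtype.ext (one_smul _ (η : FunModConst (X × X)))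
  mul_smul γ γ' η := Subtype.ext (mul_smul γ γ' (η : FunModConst (X × X)))

/-! ### Hyperbolic trigonometry in the upper half-plane -/

/-! Attach to a point of `Ω` the set of minima of a representative restricted to the diagonal, `x ↦
max (β_c x) (β_c' x + C)`. This set does not depend on the additive constant and is equivariant
under isometries, so it transports both properties from `X` to `Ω`. It is non-empty because common
sublevel sets of Busemann functions with distinct endpoints are bounded
(`IsCATNegOne.isBounded_sublevel`).

Cocompactness: a translation moves a minimum into a fixed ball, so it suffices that the points of
`Ω` with a minimum in that ball form a compact set (`IsCATNegOne.isCompact_isDiagMin`). Rays may be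
taken from one base point, where they form a compact space on which Busemann functions depend
continuously; the two Busemann terms agree at a minimum, which bounds `C`; and having a minimum is a
closed condition that forces distinct endpoints.

Proper discontinuity: the minima of all points of a compact subset of `Ω` form a bounded set
(`IsCATNegOne.isBounded_isDiagMin`, by quasi-convexity), and only finitely many elements of a
discrete group carry a point of one bounded set into another.

All curvature input passes through `IsCATNegOne.stewart_le` and its limits as points go to infinity.
-/

theorem Real.eq_of_cosh_eq {a b : ℝ} (ha : 0 ≤ a) (hb : 0 ≤ b)
    (h : Real.cosh a = Real.cosh b) : a = b := by
  have h₁ := Real.cosh_le_cosh.1 h.le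
  have h₂ := Real.cosh_le_cosh.1 h.ge
  rw [abs_of_nonneg ha, abs_of_nonneg hb] at h₁ h₂
  exact le_antisymm h₁ h₂

theorem UpperHalfPlane.cosh_dist_eq_div (z w : UpperHalfPlane) :
    Real.cosh (dist z w) =
      (z.re ^ 2 + z.im ^ 2 + w.re ^ 2 + w.im ^ 2 - 2 * z.re * w.re) / (2 * z.im * w.im) := by
  have hz := z.im_pos
  have hw := w.im_pos
  rw [UpperHalfPlane.cosh_dist, Complex.dist_eq, Complex.sq_norm, Complex.normSq_apply]
  simp only [Complex.sub_re, Complex.sub_im, UpperHalfPlane.coe_re, UpperHalfPlane.coe_im]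
  field_simp
  ring

/-- A point of the upper half-plane given by its light-cone coordinates `a = 1 / y`, `b = x / y`
and `c = (x ^ 2 + y ^ 2) / y`; the hyperbolic cosine of the distance is bilinear in these. -/
theorem UpperHalfPlane.exists_cosh_dist_eq {a b c : ℝ} (ha : 0 < a) (h : a * c - b ^ 2 = 1) :
    ∃ m : UpperHalfPlane, ∀ z : UpperHalfPlane, Real.cosh (dist z m) =
      (c / z.im + a * ((z.re ^ 2 + z.im ^ 2) / z.im)) / 2 - b * (z.re / z.im) := by
  refine ⟨⟨⟨b / a, 1 / a⟩, by simpa using ha⟩, fun z => ?_⟩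
  have hz := z.im_pos
  rw [UpperHalfPlane.cosh_dist_eq_div]
  have hc : c = (1 + b ^ 2) / a := by field_simp; linarith
  subst hc
  simp only [UpperHalfPlane.re, UpperHalfPlane.im]
  field_simp
  ring

/-- In light-cone coordinates the point at distance `s` from `p` is the combination of `p` and `q`
with weights `sinh (T - s) / sinh T` and `sinh s / sinh T`. The identity `hid` says that this vector
has norm one. -/
theorem UpperHalfPlane.exists_stewart {p q : UpperHalfPlane} (hpq : p ≠ q) {s : ℝ}
    (hs : s ∈ Icc 0 (dist p q)) : ∃ m : UpperHalfPlane, ∀ z : UpperHalfPlane,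
      Real.cosh (dist z m) * Real.sinh (dist p q) =
        Real.cosh (dist z p) * Real.sinh (dist p q - s) +
          Real.cosh (dist z q) * Real.sinh s := by
  set T := dist p q with hT
  have hTpos : 0 < T := dist_pos.2 hpq
  have hp := p.im_pos
  have hq := q.im_pos
  have hS : 0 < Real.sinh T := Real.sinh_pos_iff.2 hTpos
  have hu : 0 ≤ Real.sinh (T - s) := Real.sinh_nonneg_iff.2 (by linarith [hs.2])
  have hv : 0 ≤ Real.sinh s := Real.sinh_nonneg_iff.2 hs.1
  have huv : 0 < Real.sinh (T - s) ∨ 0 < Real.sinh s := by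
    rcases hs.1.eq_or_lt with h | h
    · left; exact Real.sinh_pos_iff.2 (by linarith)
    · right; exact Real.sinh_pos_iff.2 h
  have hc := UpperHalfPlane.cosh_dist_eq_div p q
  rw [← hT] at hc
  have hid : Real.sinh (T - s) ^ 2 + Real.sinh s ^ 2 +
      2 * Real.sinh (T - s) * Real.sinh s * Real.cosh T = Real.sinh T ^ 2 := by
    rw [Real.sinh_sub]
    have h1 := Real.cosh_sq T
    have h2 := Real.cosh_sq s
    linear_combination (Real.sinh s ^ 2) * h1 + Real.sinh T ^ 2 * h2 - 2 * Real.sinh s ^ 2 * h1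
  set S := Real.sinh T
  set u := Real.sinh (T - s)
  set v := Real.sinh s
  obtain ⟨m, hm⟩ := UpperHalfPlane.exists_cosh_dist_eq
    (a := (u / p.im + v / q.im) / S)
    (b := (u * (p.re / p.im) + v * (q.re / q.im)) / S)
    (c := (u * ((p.re ^ 2 + p.im ^ 2) / p.im) + v * ((q.re ^ 2 + q.im ^ 2) / q.im)) / S)
    (by rcases huv with h | h <;> positivity)
    (by
      rw [hc] at hid
      field_simp at hid ⊢
      linear_combination p.im * q.im * hid)
  refine ⟨m, fun z => ?_⟩
  have hz := z.im_pos
  rw [hm, UpperHalfPlane.cosh_dist_eq_div z p, UpperHalfPlane.cosh_dist_eq_div z q]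
  field_simp
  ring

/-- Stewart's formula alone forces the curve to be geodesic: at `z = p` and `z = q` it gives the
distances to the endpoints, and then at `z = k s` the distance to `k t`. -/
theorem UpperHalfPlane.exists_segment_stewart (p q : UpperHalfPlane) :
    ∃ k : ℝ → UpperHalfPlane, IsGeodesicSegment k p q ∧
      ∀ s ∈ Icc 0 (dist p q), ∀ z : UpperHalfPlane,
        Real.cosh (dist z (k s)) * Real.sinh (dist p q) =
          Real.cosh (dist z p) * Real.sinh (dist p q - s) +
            Real.cosh (dist z q) * Real.sinh s := by
  rcases eq_or_ne p q with rfl | hpq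
  · refine ⟨fun _ => p, ⟨rfl, rfl, fun s hs t ht => ?_⟩, fun s hs z => ?_⟩
    · rw [dist_self, Icc_self, mem_singleton_iff] at hs ht
      simp [hs, ht]
    · rw [dist_self, Icc_self, mem_singleton_iff] at hs
      simp [hs]
  have h : ∀ s : ℝ, ∃ m : UpperHalfPlane, s ∈ Icc 0 (dist p q) → ∀ z : UpperHalfPlane,
      Real.cosh (dist z m) * Real.sinh (dist p q) =
        Real.cosh (dist z p) * Real.sinh (dist p q - s) +
          Real.cosh (dist z q) * Real.sinh s := fun s => by
    by_cases hs : s ∈ Icc 0 (dist p q)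
    · obtain ⟨m, hm⟩ := UpperHalfPlane.exists_stewart hpq hs
      exact ⟨m, fun _ => hm⟩
    · exact ⟨p, fun h => absurd h hs⟩
  choose k hk using h
  have hTpos : 0 < dist p q := dist_pos.2 hpq
  have hS : 0 < Real.sinh (dist p q) := Real.sinh_pos_iff.2 hTpos
  have hkp : ∀ s ∈ Icc 0 (dist p q), dist p (k s) = s := fun s hs => by
    have h1 := hk s hs p
    rw [dist_self, Real.cosh_zero, Real.sinh_sub] at h1
    have h2 : Real.cosh (dist p (k s)) = Real.cosh s :=
      mul_right_cancel₀ hS.ne' (by linarith)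
    exact Real.eq_of_cosh_eq dist_nonneg hs.1 h2
  have hkq : ∀ s ∈ Icc 0 (dist p q), dist q (k s) = dist p q - s := fun s hs => by
    have h1 := hk s hs q
    rw [dist_self, Real.cosh_zero, Real.sinh_sub, dist_comm q p] at h1
    have h2 : Real.cosh (dist q (k s)) = Real.cosh (dist p q - s) := by
      refine mul_right_cancel₀ hS.ne' ?_
      rw [h1, Real.cosh_sub]
      linear_combination (-Real.sinh s) * Real.cosh_sq (dist p q)
    exact Real.eq_of_cosh_eq dist_nonneg (by linarith [hs.2]) h2
  refine ⟨k, ⟨?_, ?_, fun s hs t ht => ?_⟩, hk⟩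
  · exact (dist_eq_zero.1 (hkp 0 ⟨le_rfl, hTpos.le⟩)).symm
  · refine (dist_eq_zero.1 ?_).symm
    rw [hkq _ ⟨hTpos.le, le_rfl⟩, sub_self]
  · have h1 := hk t ht (k s)
    rw [dist_comm (k s) p, dist_comm (k s) q, hkp s hs, hkq s hs] at h1
    have h2 : Real.cosh (dist (k s) (k t)) = Real.cosh (s - t) := by
      refine mul_right_cancel₀ hS.ne' ?_
      rw [h1, Real.cosh_sub, Real.sinh_sub, Real.cosh_sub]
      ring
    rw [← Real.cosh_abs (s - t)] at h2
    exact Real.eq_of_cosh_eq dist_nonneg (abs_nonneg _) h2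

/-- Put `p = i` and `q = i * exp a`. The two distances to `r` are then linear equations for its
light-cone coordinates `A` and `D`; the remaining coordinate is a square root of `A * D - 1`, which
is non-negative because `cosh (a - b) ≤ cosh c ≤ cosh (a + b)`. -/
theorem UpperHalfPlane.exists_triangle {a b c : ℝ} (ha : 0 < a) (hb : 0 ≤ b) (hc : 0 ≤ c)
    (h₁ : c ≤ a + b) (h₂ : a ≤ b + c) (h₃ : b ≤ a + c) :
    ∃ p q r : UpperHalfPlane, dist p q = a ∧ dist p r = b ∧ dist q r = c := by
  have hS : 0 < Real.sinh a := Real.sinh_pos_iff.2 ha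
  have hlo : Real.cosh (a - b) ≤ Real.cosh c :=
    Real.cosh_le_cosh.2 (by rw [abs_of_nonneg hc, abs_le]; constructor <;> linarith)
  have hhi : Real.cosh c ≤ Real.cosh (a + b) :=
    Real.cosh_le_cosh.2 (by rw [abs_of_nonneg hc, abs_of_nonneg (by linarith)]; exact h₁)
  have hprod := mul_nonneg (sub_nonneg.2 hlo) (sub_nonneg.2 hhi)
  rw [Real.cosh_sub, Real.cosh_add] at hprod
  have hE : Real.exp a = Real.cosh a + Real.sinh a := (Real.cosh_add_sinh a).symm
  have hF : Real.exp (-a) = Real.cosh a - Real.sinh a := (Real.cosh_sub_sinh a).symm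
  have hsa := Real.cosh_sq a
  have hsb := Real.cosh_sq b
  have hcb := Real.cosh_pos b
  set A := (Real.cosh c - Real.exp (-a) * Real.cosh b) / Real.sinh a with hA
  set D := (Real.exp a * Real.cosh b - Real.cosh c) / Real.sinh a with hD
  have hsum : A + D = 2 * Real.cosh b := by
    rw [hA, hD, hE, hF]; field_simp; ring
  have hsum2 : A * Real.exp a + D * Real.exp (-a) = 2 * Real.cosh c := by
    rw [hA, hD, hE, hF]; field_simp; ring
  have hAD : 0 ≤ A * D - 1 := by
    have : A * D - 1 = (Real.cosh c - (Real.cosh a * Real.cosh b - Real.sinh a * Real.sinh b)) *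
        (Real.cosh a * Real.cosh b + Real.sinh a * Real.sinh b - Real.cosh c) /
          Real.sinh a ^ 2 := by
      rw [hA, hD, hE, hF]; field_simp
      linear_combination Real.sinh a ^ 2 * hsb
    rw [this]; positivity
  have hApos : 0 < A := by
    by_contra hneg
    push Not at hneg
    nlinarith
  obtain ⟨r, hr⟩ := UpperHalfPlane.exists_cosh_dist_eq (a := A) (b := √(A * D - 1)) (c := D) hApos
    (by rw [Real.sq_sqrt hAD]; ring)
  have hea := Real.exp_pos a
  refine ⟨⟨⟨0, 1⟩, by simp⟩, ⟨⟨0, Real.exp a⟩, hea⟩, r, ?_, ?_, ?_⟩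
  · refine Real.eq_of_cosh_eq dist_nonneg ha.le ?_
    rw [UpperHalfPlane.cosh_dist_eq_div, Real.cosh_eq,
      Real.exp_neg]
    simp only [UpperHalfPlane.re, UpperHalfPlane.im]
    field_simp
    ring
  · refine Real.eq_of_cosh_eq dist_nonneg hb ?_
    rw [hr]
    simp only [UpperHalfPlane.re, UpperHalfPlane.im]
    norm_num
    linarith
  · refine Real.eq_of_cosh_eq dist_nonneg hc ?_
    rw [hr]
    simp only [UpperHalfPlane.re, UpperHalfPlane.im]
    rw [Real.exp_neg] at hsum2
    field_simp at hsum2 ⊢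
    simp
    linarith

/-- In a `CAT(-1)` space, Stewart's formula of hyperbolic trigonometry is an inequality. -/
theorem IsCATNegOne.stewart_le {X : Type*} [MetricSpace X] (hX : IsCATNegOne X) {p q : X}
    {σ : ℝ → X} (hσ : IsGeodesicSegment σ p q) {s : ℝ} (hs : s ∈ Icc 0 (dist p q)) (z : X) :
    Real.cosh (dist z (σ s)) * Real.sinh (dist p q) ≤
      Real.cosh (dist z p) * Real.sinh (dist p q - s) + Real.cosh (dist z q) * Real.sinh s := by
  rcases eq_or_ne p q with rfl | hpq
  · rw [dist_self, Icc_self, mem_singleton_iff] at hs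
    simp [hs]
  obtain ⟨p₀, q₀, z₀, h₁, h₂, h₃⟩ := UpperHalfPlane.exists_triangle (dist_pos.2 hpq)
    (dist_nonneg (x := p) (y := z)) (dist_nonneg (x := q) (y := z))
    (by rw [dist_comm p q]; exact dist_triangle _ _ _)
    (by rw [dist_comm q z]; exact dist_triangle _ _ _) (dist_triangle _ _ _)
  obtain ⟨k, hk, hkS⟩ := UpperHalfPlane.exists_segment_stewart p₀ q₀
  obtain ⟨k', hk', -⟩ := UpperHalfPlane.exists_segment_stewart p₀ z₀
  obtain ⟨τ, hτ⟩ := hX.exists_segment p z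
  -- The point on the second side is its far endpoint, the vertex `z`.
  have h := hX.comparison p q z σ τ hσ hτ p₀ q₀ z₀ k k' h₁ h₂ h₃ hk hk' s hs (dist p z)
    ⟨dist_nonneg, le_rfl⟩
  rw [hτ.map_dist, ← h₂, hk'.map_dist, dist_comm, dist_comm _ z₀] at h
  have hst := hkS s (by rwa [h₁]) z₀
  rw [h₁, dist_comm z₀ p₀, dist_comm z₀ q₀, h₂, h₃, dist_comm p z, dist_comm q z] at hst
  rw [← hst]
  have hS : 0 < Real.sinh (dist p q) := Real.sinh_pos_iff.2 (dist_pos.2 hpq)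
  gcongr
  exact Real.cosh_le_cosh.2 (by rwa [abs_of_nonneg dist_nonneg, abs_of_nonneg dist_nonneg])

/-! ### Limits of the hyperbolic Stewart inequality -/

theorem Real.tendsto_two_mul_cosh_mul_exp {ι : Type*} {l : Filter ι} {u T : ι → ℝ} {B : ℝ}
    (hT : Tendsto T l atTop) (hu : Tendsto (fun n => u n - T n) l (𝓝 B)) :
    Tendsto (fun n => 2 * Real.cosh (u n) * Real.exp (-T n)) l (𝓝 (Real.exp B)) := by
  have h₁ : Tendsto (fun n => Real.exp (u n - T n)) l (𝓝 (Real.exp B)) :=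
    (Real.continuous_exp.tendsto B).comp hu
  have h₂ : Tendsto (fun n => Real.exp (-(u n - T n) + -(2 * T n))) l (𝓝 0) :=
    Real.tendsto_exp_atBot.comp
      (hu.neg.add_atBot (tendsto_neg_atTop_atBot.comp (hT.const_mul_atTop two_pos)))
  have h := h₁.add h₂
  rw [add_zero] at h
  refine h.congr fun n => ?_
  rw [Real.cosh_eq, mul_div_cancel₀ _ two_ne_zero, add_mul, ← Real.exp_add, ← Real.exp_add]
  congr 2
  ring

theorem Real.tendsto_two_mul_sinh_sub_mul_exp {ι : Type*} {l : Filter ι} {T : ι → ℝ}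
    (hT : Tendsto T l atTop) (s : ℝ) :
    Tendsto (fun n => 2 * Real.sinh (T n - s) * Real.exp (-T n)) l (𝓝 (Real.exp (-s))) := by
  have h₂ : Tendsto (fun n => Real.exp (s + -(2 * T n))) l (𝓝 0) :=
    Real.tendsto_exp_atBot.comp (tendsto_const_nhds.add_atBot
      (tendsto_neg_atTop_atBot.comp (hT.const_mul_atTop two_pos)))
  have h := (tendsto_const_nhds (x := Real.exp (-s)) (f := l)).sub h₂
  rw [sub_zero] at h
  refine h.congr fun n => ?_
  rw [Real.sinh_eq, mul_div_cancel₀ _ two_ne_zero, sub_mul, ← Real.exp_add, ← Real.exp_add]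
  congr 2 <;> ring

/-- Multiplied by `2 * exp (-T)`, Stewart's inequality tends to `cosh b ≤ cosh a * exp (-s) + exp B
* sinh s`; multiply by `2 * exp (-s)` and use `exp b ≤ 2 * cosh b` and `2 * sinh s * exp (-s) ≤ 1`.
Here `a`, `w`, `u` stand for the distances to the start of a segment of length `T`, to its point at
parameter `s`, and to its far end. -/
theorem exp_sub_le_of_tendsto {ι : Type*} {l : Filter ι} [l.NeBot] {T u w : ι → ℝ} {a b s B : ℝ}
    (hT : Tendsto T l atTop) (hu : Tendsto (fun n => u n - T n) l (𝓝 B))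
    (hw : Tendsto w l (𝓝 b))
    (h : ∀ᶠ n in l, Real.cosh (w n) * Real.sinh (T n) ≤
      Real.cosh a * Real.sinh (T n - s) + Real.cosh (u n) * Real.sinh s) :
    Real.exp (b - s) ≤ Real.exp B + 2 * Real.exp (-(2 * s)) * Real.cosh a := by
  have h₀ := Real.tendsto_two_mul_sinh_sub_mul_exp hT 0
  simp only [sub_zero, neg_zero, Real.exp_zero] at h₀
  have h₁ := ((Real.continuous_cosh.tendsto b).comp hw).mul h₀
  have h₂ := ((Real.tendsto_two_mul_sinh_sub_mul_exp hT s).const_mul (Real.cosh a)).add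
    ((Real.tendsto_two_mul_cosh_mul_exp hT hu).mul_const (Real.sinh s))
  have key : Real.cosh b * 1 ≤ Real.cosh a * Real.exp (-s) + Real.exp B * Real.sinh s := by
    refine le_of_tendsto_of_tendsto h₁ h₂ (h.mono fun n hn => ?_)
    have := mul_le_mul_of_nonneg_right hn (mul_nonneg two_pos.le (Real.exp_pos (-T n)).le)
    simp only [Function.comp_apply]
    linarith
  have hb : Real.exp b ≤ 2 * Real.cosh b := by
    rw [Real.cosh_eq]; linarith [Real.exp_pos (-b)]
  have hsinh : 2 * Real.sinh s * Real.exp (-s) ≤ 1 := by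
    rw [Real.sinh_eq, mul_div_cancel₀ _ two_ne_zero, sub_mul, ← Real.exp_add, ← Real.exp_add,
      add_neg_cancel, Real.exp_zero]
    linarith [Real.exp_pos (-s + -s)]
  have hs2 : Real.exp (-(2 * s)) = Real.exp (-s) * Real.exp (-s) := by
    rw [← Real.exp_add]; congr 1; ring
  rw [sub_eq_add_neg, Real.exp_add, hs2]
  nlinarith [Real.exp_pos (-s), Real.exp_pos B, mul_le_mul_of_nonneg_left hsinh (Real.exp_pos B).le,
    mul_le_mul_of_nonneg_right (hb.trans (by linarith :
      2 * Real.cosh b ≤ 2 * (Real.cosh a * Real.exp (-s) + Real.exp B * Real.sinh s)))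
      (Real.exp_pos (-s)).le]

/-! ### Busemann functions -/

section Busemann

variable {X : Type*} [MetricSpace X]

theorem GeodesicRay.dist_eq (c : GeodesicRay X) (s t : NNReal) :
    dist (c s) (c t) = |(s : ℝ) - t| := by
  rw [c.isometry_toFun.dist_eq, NNReal.dist_eq]

theorem GeodesicRay.dist_zero (c : GeodesicRay X) (t : NNReal) : dist (c 0) (c t) = t := by
  rw [c.dist_eq]; simp

theorem antitone_dist_sub (c : GeodesicRay X) (x : X) :
    Antitone (fun t : NNReal => dist x (c t) - (t : ℝ)) := by
  intro s t hst
  have h1 := dist_triangle x (c s) (c t)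
  have h2 : (s : ℝ) ≤ t := by exact_mod_cast hst
  rw [c.dist_eq, abs_sub_comm, abs_of_nonneg (by linarith)] at h1
  show dist x (c t) - (t : ℝ) ≤ dist x (c s) - (s : ℝ)
  linarith

theorem busemann_le_dist_sub (c : GeodesicRay X) (x : X) (t : NNReal) :
    busemann c x ≤ dist x (c t) - t :=
  (antitone_dist_sub c x).le_of_tendsto (tendsto_busemann c x) t

theorem busemann_le_add_dist (c : GeodesicRay X) (x y : X) :
    busemann c x ≤ busemann c y + dist x y :=
  le_of_tendsto_of_tendsto' (tendsto_busemann c x) ((tendsto_busemann c y).add_const _)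
    (fun t => by linarith [dist_triangle x y (c t)])

theorem abs_busemann_sub_le (c : GeodesicRay X) (x y : X) :
    |busemann c x - busemann c y| ≤ dist x y := by
  have h₁ := busemann_le_add_dist c x y
  have h₂ := busemann_le_add_dist c y x
  rw [dist_comm y x] at h₂
  rw [abs_le]
  constructor <;> linarith

theorem busemann_apply (c : GeodesicRay X) (t : NNReal) : busemann c (c t) = -t := by
  refine le_antisymm ?_ ?_
  · simpa using busemann_le_dist_sub c (c t) t
  · refine ge_of_tendsto (tendsto_busemann c (c t)) (Eventually.of_forall fun s => ?_)
    rw [c.dist_eq]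
    linarith [neg_abs_le ((t : ℝ) - s), le_abs_self ((s : ℝ) - t), abs_sub_comm (t : ℝ) s]

theorem GeodesicRay.isGeodesicSegment (c : GeodesicRay X) (T : NNReal) :
    IsGeodesicSegment (fun s => c s.toNNReal) (c 0) (c T) where
  map_zero := by simp
  map_dist := by simp [c.dist_zero]
  dist_eq s hs t ht := by
    rw [c.dist_eq, Real.coe_toNNReal _ hs.1, Real.coe_toNNReal _ ht.1]

theorem tendsto_dist_sub_dist (c : GeodesicRay X) (x y : X) :
    Tendsto (fun t : NNReal => dist x (c t) - dist y (c t)) atTop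
      (𝓝 (busemann c x - busemann c y)) :=
  ((tendsto_busemann c x).sub (tendsto_busemann c y)).congr fun t => by ring

theorem tendsto_dist_ray_atTop (c : GeodesicRay X) (x : X) :
    Tendsto (fun t : NNReal => dist x (c t)) atTop atTop := by
  refine ((tendsto_busemann c x).add_atTop (NNReal.tendsto_coe_atTop.2 tendsto_id)).congr
    fun t => ?_
  simp

/-- The distance functions of a ray converge exponentially fast to the Busemann function,
locally uniformly in the base point. -/
theorem IsCATNegOne.exp_dist_sub_le (hX : IsCATNegOne X) (c : GeodesicRay X) (z : X)
    (s : NNReal) : Real.exp (dist z (c s) - s) ≤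
      Real.exp (busemann c z) + 2 * Real.exp (-(2 * s)) * Real.cosh (dist z (c 0)) := by
  refine exp_sub_le_of_tendsto (l := atTop) (T := fun t : NNReal => (t : ℝ)) (s := s)
    (NNReal.tendsto_coe_atTop.2 tendsto_id) (tendsto_busemann c z) tendsto_const_nhds ?_
  filter_upwards [eventually_ge_atTop s] with t ht
  have h := hX.stewart_le (c.isGeodesicSegment t) (s := s)
    (by rw [c.dist_zero]; exact ⟨s.2, by exact_mod_cast ht⟩) z
  rwa [c.dist_zero, Real.toNNReal_coe] at h

/-- Stewart's inequality for the point `c t`, scaled by `2 * exp (-t)`, in the limit `t → ∞`. -/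
theorem IsCATNegOne.exp_busemann_le (hX : IsCATNegOne X) (c : GeodesicRay X) {p q : X}
    {σ : ℝ → X} (hσ : IsGeodesicSegment σ p q) {s : ℝ} (hs : s ∈ Icc 0 (dist p q)) :
    Real.exp (busemann c (σ s)) * Real.sinh (dist p q) ≤
      Real.exp (busemann c p) * Real.sinh (dist p q - s) +
        Real.exp (busemann c q) * Real.sinh s := by
  have hT : Tendsto (fun t : NNReal => (t : ℝ)) atTop atTop :=
    NNReal.tendsto_coe_atTop.2 tendsto_id
  have h := fun x => Real.tendsto_two_mul_cosh_mul_exp hT (tendsto_busemann c x)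
  refine le_of_tendsto_of_tendsto' ((h (σ s)).mul_const _)
    (((h p).mul_const _).add ((h q).mul_const _)) fun t => ?_
  have h₁ := mul_le_mul_of_nonneg_right (hX.stewart_le hσ hs (c t))
    (mul_nonneg two_pos.le (Real.exp_pos (-(t : ℝ))).le)
  simp only [dist_comm (c t)] at h₁
  linarith

/-- Busemann functions are quasi-convex. -/
theorem IsCATNegOne.busemann_le_max (hX : IsCATNegOne X) (c : GeodesicRay X) {p q : X}
    {σ : ℝ → X} (hσ : IsGeodesicSegment σ p q) {s : ℝ} (hs : s ∈ Icc 0 (dist p q)) :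
    busemann c (σ s) ≤ max (busemann c p) (busemann c q) := by
  rcases eq_or_ne p q with rfl | hpq
  · rw [dist_self, Icc_self, mem_singleton_iff] at hs
    rw [hs, hσ.map_zero]
    exact le_max_left _ _
  set M := max (busemann c p) (busemann c q)
  have h := hX.exp_busemann_le c hσ hs
  have hS : 0 < Real.sinh (dist p q) := Real.sinh_pos_iff.2 (dist_pos.2 hpq)
  have hu : 0 ≤ Real.sinh (dist p q - s) := Real.sinh_nonneg_iff.2 (by linarith [hs.2])
  have hv : 0 ≤ Real.sinh s := Real.sinh_nonneg_iff.2 hs.1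
  -- The Stewart weights have sum at most one.
  have hsum : Real.sinh (dist p q - s) + Real.sinh s ≤ Real.sinh (dist p q) := by
    have h₁ : Real.sinh (dist p q) = Real.sinh (dist p q - s) * Real.cosh s +
        Real.cosh (dist p q - s) * Real.sinh s := by
      rw [← Real.sinh_add]; congr 1; ring
    rw [h₁]
    nlinarith [Real.one_le_cosh s, Real.one_le_cosh (dist p q - s)]
  have hp : Real.exp (busemann c p) ≤ Real.exp M := Real.exp_le_exp.2 (le_max_left _ _)
  have hq : Real.exp (busemann c q) ≤ Real.exp M := Real.exp_le_exp.2 (le_max_right _ _)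
  have : Real.exp (busemann c (σ s)) * Real.sinh (dist p q) ≤
      Real.exp M * Real.sinh (dist p q) := by
    nlinarith [mul_le_mul_of_nonneg_right hp hu, mul_le_mul_of_nonneg_right hq hv,
      mul_le_mul_of_nonneg_left hsum (Real.exp_pos M).le]
  exact Real.exp_le_exp.1 (le_of_mul_le_mul_right this hS)

/-- In a proper geodesic space, segments from a fixed point to points that go to infinity
subconverge to a ray. -/
theorem IsCATNegOne.exists_ray_of_tendsto [ProperSpace X] (hX : IsCATNegOne X) {o : X}
    {x : ℕ → X} (hx : Tendsto (fun n => dist o (x n)) atTop atTop) :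
    ∃ (U : Ultrafilter ℕ) (σ : ℕ → ℝ → X) (c : GeodesicRay X), (U : Filter ℕ) ≤ atTop ∧
      (∀ n, IsGeodesicSegment (σ n) o (x n)) ∧ c 0 = o ∧
        ∀ t : NNReal, Tendsto (fun n => σ n t) U (𝓝 (c t)) := by
  choose σ hσ using fun n => hX.exists_segment o (x n)
  -- An ultrafilter provides the limits for all `t` at once and replaces a diagonal extraction.
  have hU : ((Ultrafilter.of atTop : Ultrafilter ℕ) : Filter ℕ) ≤ atTop := Ultrafilter.of_le _
  set U : Ultrafilter ℕ := Ultrafilter.of atTop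
  have hev : ∀ t : NNReal, ∀ᶠ n in (U : Filter ℕ), (t : ℝ) ≤ dist o (x n) := fun t =>
    hU (hx.eventually_ge_atTop _)
  have hlim : ∀ t : NNReal, ∃ y, Tendsto (fun n => σ n t) U (𝓝 y) := fun t => by
    have hmem : ∀ᶠ n in (U : Filter ℕ), σ n t ∈ Metric.closedBall o t := by
      filter_upwards [hev t] with n hn
      have h := (hσ n).dist_eq t ⟨t.2, hn⟩ 0 ⟨le_rfl, dist_nonneg⟩
      rw [(hσ n).map_zero] at h
      rw [Metric.mem_closedBall, h]
      simp
    obtain ⟨y, -, hy⟩ := (isCompact_closedBall o (t : ℝ)).ultrafilter_le_nhds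
      (U.map fun n => σ n t) (le_principal_iff.2 hmem)
    exact ⟨y, hy⟩
  choose f hf using hlim
  refine ⟨U, σ, ⟨f, Isometry.of_dist_eq fun s t => ?_⟩, hU, hσ, ?_, hf⟩
  · refine tendsto_nhds_unique ((hf s).dist (hf t))
      (tendsto_const_nhds.congr' ?_)
    filter_upwards [hev s, hev t] with n hs ht
    rw [(hσ n).dist_eq s ⟨s.2, hs⟩ t ⟨t.2, ht⟩, NNReal.dist_eq]
  · refine tendsto_nhds_unique (hf 0) (tendsto_const_nhds.congr fun n => ?_)
    rw [NNReal.coe_zero, (hσ n).map_zero]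

/-- Every Busemann function is, up to a constant, that of a ray from a given point. -/
theorem IsCATNegOne.exists_ray_busemann_eq [ProperSpace X] (hX : IsCATNegOne X)
    (c : GeodesicRay X) (o : X) :
    ∃ c' : GeodesicRay X, c' 0 = o ∧ ∀ z, busemann c' z = busemann c z - busemann c o := by
  have hN : Tendsto (fun n : ℕ => (n : NNReal)) atTop atTop := tendsto_natCast_atTop_atTop
  obtain ⟨U, σ, c', hU, hσ, h0, hlim⟩ := hX.exists_ray_of_tendsto (o := o)
    ((tendsto_dist_ray_atTop c o).comp hN)
  have hT := ((tendsto_dist_ray_atTop c o).comp hN).mono_left hU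
  have hu := fun z => ((tendsto_dist_sub_dist c z o).comp hN).mono_left hU
  have hev : ∀ t : NNReal, ∀ᶠ n in (U : Filter ℕ), (t : ℝ) ≤ dist o (c (n : ℕ)) := fun t =>
    hT.eventually_ge_atTop _
  refine ⟨c', h0, fun z => le_antisymm ?_ ?_⟩
  -- The upper bound needs curvature: the limiting Stewart inequality for the segments from `o` to
  -- `c n` has an error that vanishes as `s → ∞`.
  · rw [← Real.exp_le_exp]
    have h₁ : ∀ s : NNReal, Real.exp (busemann c' z) ≤ Real.exp (busemann c z - busemann c o) +
        2 * Real.exp (-(2 * s)) * Real.cosh (dist z o) := fun s => by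
      refine (Real.exp_le_exp.2 (busemann_le_dist_sub c' z s)).trans ?_
      refine exp_sub_le_of_tendsto (s := s) hT (hu z) (tendsto_const_nhds.dist (hlim s)) ?_
      filter_upwards [hev s] with n hn
      exact hX.stewart_le (hσ n) ⟨s.2, hn⟩ z
    have h₂ : Tendsto (fun s : NNReal => Real.exp (busemann c z - busemann c o) +
        2 * Real.exp (-(2 * s)) * Real.cosh (dist z o)) atTop
        (𝓝 (Real.exp (busemann c z - busemann c o) + 2 * 0 * Real.cosh (dist z o))) := by
      refine ((Tendsto.const_mul 2 ?_).mul_const _).const_add _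
      exact Real.tendsto_exp_atBot.comp (tendsto_neg_atTop_atBot.comp
        ((NNReal.tendsto_coe_atTop.2 tendsto_id).const_mul_atTop two_pos))
    have := ge_of_tendsto' h₂ h₁
    simpa using this
  -- The lower bound is the triangle inequality through the point `σ n s`.
  · refine ge_of_tendsto' (tendsto_busemann c' z) fun s => ?_
    refine le_of_tendsto_of_tendsto (hu z)
      ((tendsto_const_nhds.dist (hlim s)).sub tendsto_const_nhds) ?_
    filter_upwards [hev s] with n hn
    have h := (hσ n).dist_eq s ⟨s.2, hn⟩ _ ⟨dist_nonneg, le_rfl⟩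
    rw [(hσ n).map_dist, abs_sub_comm, abs_of_nonneg (by linarith)] at h
    simp only [Function.comp_apply] at hn h ⊢
    linarith [dist_triangle z (σ n s) (c n)]

/-! ### Asymptotic rays -/

/-- Apply `IsCATNegOne.exp_dist_sub_le` at `z = c' t` and `s = t`: both terms on the right are
`O(exp (-t))`, so `dist (c t) (c' t)` is bounded. -/
theorem IsCATNegOne.endpoint_eq_of_busemann_le (hX : IsCATNegOne X) {c c' : GeodesicRay X}
    {K : ℝ} (h : ∀ t : NNReal, busemann c (c' t) ≤ K - t) : c.endpoint = c'.endpoint := by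
  set L := dist (c' 0) (c 0)
  refine Quotient.sound ⟨Real.log (Real.exp K + 2 * Real.exp L), fun t => ?_⟩
  have h₁ := hX.exp_dist_sub_le c (c' t) t
  have h₂ : dist (c' t) (c 0) ≤ t + L := by
    have := dist_triangle (c' t) (c' 0) (c 0)
    rwa [dist_comm (c' t) (c' 0), c'.dist_zero] at this
  have h₃ : Real.cosh (dist (c' t) (c 0)) ≤ Real.exp (t + L) := by
    have : Real.exp (-(t + L)) ≤ Real.exp (t + L) :=
      Real.exp_le_exp.2 (by linarith [t.2, dist_nonneg (x := c' 0) (y := c 0)])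
    have h₄ : Real.cosh (dist (c' t) (c 0)) ≤ Real.cosh (t + L) := Real.cosh_le_cosh.2 (by
      rw [abs_of_nonneg dist_nonneg]; exact h₂.trans (le_abs_self _))
    rw [Real.cosh_eq (t + L)] at h₄
    linarith
  have h₅ : 2 * Real.exp (-(2 * t)) * Real.cosh (dist (c' t) (c 0)) ≤
      2 * Real.exp (-(2 * t)) * Real.exp (t + L) := by gcongr
  have h₆ : Real.exp (busemann c (c' t)) ≤ Real.exp (K - t) := Real.exp_le_exp.2 (h t)
  rw [dist_comm, Real.le_log_iff_exp_le (by positivity)]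
  have e₁ : Real.exp (dist (c' t) (c t)) = Real.exp (dist (c' t) (c t) - t) * Real.exp t := by
    rw [← Real.exp_add]; congr 1; ring
  have e₂ : Real.exp K + 2 * Real.exp L =
      (Real.exp (K - t) + 2 * Real.exp (-(2 * t)) * Real.exp (t + L)) * Real.exp t := by
    rw [add_mul, ← Real.exp_add, mul_assoc, mul_assoc, ← Real.exp_add, ← Real.exp_add]
    congr 3 <;> ring_nf
  rw [e₁, e₂]
  gcongr
  linarith

/-- Along `c`, the Busemann functions of two asymptotic rays both tend to `-∞`. Distinctness of
endpoints, not a closed condition, thus follows from a lower bound. -/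
theorem endpoint_ne_of_le_max {c c' : GeodesicRay X} {C m : ℝ}
    (h : ∀ x, m ≤ max (busemann c x) (busemann c' x + C)) : c.endpoint ≠ c'.endpoint := by
  intro heq
  obtain ⟨K, hK⟩ := Quotient.exact heq
  obtain ⟨t, ht⟩ : ∃ t : NNReal, max (-m) (K + C - m) < t :=
    ⟨(max (-m) (K + C - m) + 1).toNNReal,
      (lt_add_one _).trans_le (Real.le_coe_toNNReal _)⟩
  have h₁ := busemann_le_add_dist c' (c t) (c' t)
  have h₂ := h (c t)
  have h₃ := hK t
  rw [busemann_apply] at h₁ h₂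
  rw [max_lt_iff] at ht
  rcases le_max_iff.1 h₂ with h₄ | h₄ <;> linarith

/-- Segments from `o` to an unbounded sequence in the sublevel set subconverge to a ray `r`. Since
the Busemann functions stay bounded above at the far ends, `IsCATNegOne.exp_busemann_le` makes both
decrease at unit rate along `r`, so `r` is asymptotic to both rays. -/
theorem IsCATNegOne.isBounded_sublevel [ProperSpace X] (hX : IsCATNegOne X)
    {c c' : GeodesicRay X} (hne : c.endpoint ≠ c'.endpoint) (M : ℝ) :
    Bornology.IsBounded {x | busemann c x ≤ M ∧ busemann c' x ≤ M} := by
  set o := c 0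
  by_contra hb
  have hex : ∀ n : ℕ, ∃ x, (busemann c x ≤ M ∧ busemann c' x ≤ M) ∧ (n : ℝ) < dist o x := by
    intro n
    by_contra hn
    push Not at hn
    exact hb (Metric.isBounded_closedBall.subset (t := Metric.closedBall o n) fun x hx => by
      rw [Metric.mem_closedBall, dist_comm]; exact hn x hx)
  choose x hx hxo using hex
  have hT : Tendsto (fun n => dist o (x n)) atTop atTop :=
    tendsto_atTop_mono (fun n => (hxo n).le) tendsto_natCast_atTop_atTop
  obtain ⟨U, σ, r, hU, hσ, h0, hlim⟩ := hX.exists_ray_of_tendsto hT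
  have hTU := hT.mono_left hU
  have key : ∀ e : GeodesicRay X, (∀ n, busemann e (x n) ≤ M) →
      e.endpoint = r.endpoint := by
    intro e he
    refine hX.endpoint_eq_of_busemann_le (K := busemann e o) fun t => ?_
    rw [← Real.exp_le_exp, sub_eq_add_neg, Real.exp_add]
    have h₀ := Real.tendsto_two_mul_sinh_sub_mul_exp hTU 0
    simp only [sub_zero, neg_zero, Real.exp_zero] at h₀
    have hexp : Tendsto (fun n => Real.exp (-dist o (x n))) U (𝓝 0) :=
      Real.tendsto_exp_atBot.comp (tendsto_neg_atTop_atBot.comp hTU)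
    have h₁ := ((Real.continuous_exp.comp (continuous_busemann e)).tendsto _).comp (hlim t)
      |>.mul h₀
    have h₂ := ((Real.tendsto_two_mul_sinh_sub_mul_exp hTU t).const_mul
      (Real.exp (busemann e o))).add (hexp.const_mul (2 * Real.exp M * Real.sinh t))
    rw [mul_one, mul_zero, add_zero] at *
    refine le_of_tendsto_of_tendsto h₁ h₂ ?_
    filter_upwards [hTU.eventually_ge_atTop (t : ℝ)] with n hn
    have h₃ := hX.exp_busemann_le e (hσ n) (s := t) ⟨t.2, hn⟩
    have h₄ : Real.exp (busemann e (x n)) * Real.sinh t ≤ Real.exp M * Real.sinh t :=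
      mul_le_mul_of_nonneg_right (Real.exp_le_exp.2 (he n)) (Real.sinh_nonneg_iff.2 t.coe_nonneg)
    have h₅ := mul_le_mul_of_nonneg_right (h₃.trans (add_le_add_right h₄ _))
      (mul_nonneg two_pos.le (Real.exp_pos (-dist o (x n))).le)
    simp only [Function.comp_apply]
    linarith
  exact hne ((key c fun n => (hx n).1).trans (key c' fun n => (hx n).2).symm)

end Busemann

/-! ### Maxima of Busemann functions as horofunctions of the product -/

section HorofunctionBoundary

variable {X : Type*} [MetricSpace X]

@[simp]
theorem maxBusemann_apply (c c' : GeodesicRay X) (C : ℝ) (z : X × X) :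
    maxBusemann c c' C z = max (busemann c z.1) (busemann c' z.2 + C) := rfl

theorem FunModConst.continuous_mk (Y : Type*) [TopologicalSpace Y] :
    Continuous (FunModConst.mk (Y := Y)) :=
  continuous_quotient_mk'

theorem FunModConst.isOpenMap_mk (Y : Type*) [TopologicalSpace Y] :
    IsOpenMap (FunModConst.mk (Y := Y)) :=
  QuotientAddGroup.isOpenMap_coe

theorem mk_maxBusemann_mem_horofunctionBoundary (c c' : GeodesicRay X) (C : ℝ) :
    FunModConst.mk (maxBusemann c c' C) ∈ horofunctionBoundary (X × X) := by
  refine ⟨?_, ?_⟩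
  -- The function is the limit of normalized distances to `(c (t + a), c' (t + b))`. The delays, the
  -- negative and positive parts of `C`, produce the constant; monotonicity in `t` makes the
  -- convergence locally uniform (Dini).
  · set a : NNReal := (-C).toNNReal
    set b : NNReal := C.toNNReal
    have hab : (b : ℝ) - a = C := by
      simp only [a, b, Real.coe_toNNReal']
      rcases le_total 0 C with h | h
      · rw [max_eq_left h, max_eq_right (by linarith)]; ring
      · rw [max_eq_right h, max_eq_left (by linarith)]; ring
    let F : NNReal → C(X × X, ℝ) := fun t =>
      ⟨fun z => dist (c (t + a), c' (t + b)) z - ((t : ℝ) + a), by fun_prop⟩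
    have hF : ∀ t z, F t z = max (dist z.1 (c (t + a)) - ((t + a : NNReal) : ℝ))
        (dist z.2 (c' (t + b)) - ((t + b : NNReal) : ℝ) + C) := fun t z => by
      show max (dist (c (t + a)) z.1) (dist (c' (t + b)) z.2) - ((t : ℝ) + a) = _
      rw [← max_sub_sub_right, dist_comm _ z.1, dist_comm _ z.2, ← hab]
      push_cast
      congr 1
      ring
    have hadd : ∀ a : NNReal, Tendsto (fun t => t + a) atTop atTop := fun a =>
      tendsto_atTop_mono (fun t => le_self_add) tendsto_id
    have hlim : Tendsto F atTop (𝓝 (maxBusemann c c' C)) := by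
      refine ContinuousMap.tendsto_of_antitone_of_pointwise (fun s t hst z => ?_) fun z => ?_
      · show F t z ≤ F s z
        rw [hF, hF]
        exact max_le_max (antitone_dist_sub c z.1 (add_le_add_left hst a))
          (add_le_add_left (antitone_dist_sub c' z.2 (add_le_add_left hst b)) C)
      · simp only [hF]
        exact ((tendsto_busemann c z.1).comp (hadd a)).max
          (((tendsto_busemann c' z.2).comp (hadd b)).add_const C)
    refine mem_closure_of_tendsto (((FunModConst.continuous_mk _).tendsto _).comp hlim)
      (Eventually.of_forall fun t => ⟨(c (t + a), c' (t + b)), ?_⟩)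
    exact FunModConst.mk_eq_mk.2 ⟨-((t : ℝ) + a), fun z => rfl⟩
  -- A distance function is bounded below, whereas the maximum tends to `-∞` along `(c t, c' t)`.
  · rintro ⟨p, hp⟩
    obtain ⟨a, ha⟩ := FunModConst.mk_eq_mk.1 hp
    have key : ∀ t : NNReal, a ≤ max (-(t : ℝ)) (-t + C) := fun t => by
      have h : max (busemann c (c t)) (busemann c' (c' t) + C) = dist p (c t, c' t) + a :=
        ha (c t, c' t)
      rw [busemann_apply, busemann_apply] at h
      rw [h]
      linarith [dist_nonneg (x := p) (y := (c t, c' t))]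
    have h := key (max (-a) (C - a) + 1).toNNReal
    have h₁ := Real.le_coe_toNNReal (max (-a) (C - a) + 1)
    rcases le_max_iff.1 h with h | h
    · linarith [le_max_left (-a) (C - a)]
    · linarith [le_max_right (-a) (C - a)]

theorem mk_maxBusemann_mem_idealDomain {c c' : GeodesicRay X} {C : ℝ}
    (h : c.endpoint ≠ c'.endpoint) : FunModConst.mk (maxBusemann c c' C) ∈ idealDomain X :=
  ⟨mk_maxBusemann_mem_horofunctionBoundary c c' C, c, c', C, h, rfl⟩

/-! ### Minima on the diagonal -/

/-- The representatives of `η` are minimal on the diagonal at `(x, x)`. -/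
def IsDiagMin (η : FunModConst (X × X)) (x : X) : Prop :=
  ∃ f : C(X × X, ℝ), FunModConst.mk f = η ∧ ∀ y, f (x, x) ≤ f (y, y)

theorem isDiagMin_mk {f : C(X × X, ℝ)} {x : X} :
    IsDiagMin (FunModConst.mk f) x ↔ ∀ y, f (x, x) ≤ f (y, y) := by
  refine ⟨?_, fun h => ⟨f, rfl, h⟩⟩
  rintro ⟨g, hg, h⟩ y
  obtain ⟨a, ha⟩ := FunModConst.mk_eq_mk.1 hg
  rw [ha, ha]
  linarith [h y]

theorem IsDiagMin.smul {η : FunModConst (X × X)} {x : X} (h : IsDiagMin η x) (γ : X ≃ᵢ X) :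
    IsDiagMin (γ • η) (γ • x) := by
  obtain ⟨f, rfl, h⟩ := h
  rw [FunModConst.smul_mk, isDiagMin_mk]
  intro y
  show f (γ⁻¹ • γ • x, γ⁻¹ • γ • x) ≤ f (γ⁻¹ • y, γ⁻¹ • y)
  rw [inv_smul_smul]
  exact h _

theorem IsCATNegOne.exists_isDiagMin [ProperSpace X] (hX : IsCATNegOne X) {η : FunModConst (X × X)}
    (hη : η ∈ idealDomain X) : ∃ x, IsDiagMin η x := by
  obtain ⟨-, c, c', C, hne, rfl⟩ := hη
  set h : X → ℝ := fun x => maxBusemann c c' C (x, x)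
  have hcont : Continuous h := by fun_prop
  set S := {x | h x ≤ h (c 0)}
  have hS : IsCompact S := by
    refine Metric.isCompact_of_isClosed_isBounded (isClosed_le hcont continuous_const) ?_
    refine (hX.isBounded_sublevel hne (max (h (c 0)) (h (c 0) - C))).subset fun x hx => ?_
    obtain ⟨h₁, h₂⟩ := max_le_iff.1 (show max (busemann c x) (busemann c' x + C) ≤ _ from hx)
    exact ⟨h₁.trans (le_max_left _ _), le_max_of_le_right (by linarith)⟩
  obtain ⟨x, hx, hmin⟩ := hS.exists_isMinOn ⟨c 0, le_refl (h (c 0))⟩ hcont.continuousOn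
  refine ⟨x, isDiagMin_mk.2 fun y => ?_⟩
  by_cases hy : y ∈ S
  · exact hmin hy
  · exact le_trans hx (not_le.1 hy).le

/-- If the second term were strictly larger at `x`, moving from `x` towards the endpoint of `c'` by
half the gap would lower it at unit speed, while the first term grows at most at unit speed; the
maximum would drop. -/
theorem IsCATNegOne.busemann_add_le_of_isMin [ProperSpace X] (hX : IsCATNegOne X) {c c' : GeodesicRay X} {C : ℝ}
    {x : X} (h : ∀ y, max (busemann c x) (busemann c' x + C) ≤
      max (busemann c y) (busemann c' y + C)) : busemann c' x + C ≤ busemann c x := by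
  by_contra! hlt
  obtain ⟨r, hr0, hr⟩ := hX.exists_ray_busemann_eq c' x
  set t : NNReal := ((busemann c' x + C - busemann c x) / 2).toNNReal
  have ht : (t : ℝ) = (busemann c' x + C - busemann c x) / 2 :=
    Real.coe_toNNReal _ (by linarith)
  have h₁ := hr (r t)
  rw [busemann_apply] at h₁
  have h₂ := busemann_le_add_dist c (r t) x
  rw [dist_comm, ← hr0, r.dist_zero, hr0] at h₂
  have h₃ := (le_max_right _ _).trans (h (r t))
  rcases le_max_iff.1 h₃ with h₄ | h₄ <;> linarith

/-- Exchanging the rays and negating `C` changes the diagonal function by a constant, so the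
one-sided bound holds both ways. The equality controls `C` by the position of the minimum. -/
theorem IsCATNegOne.busemann_eq_of_isDiagMin [ProperSpace X] (hX : IsCATNegOne X) {c c' : GeodesicRay X} {C : ℝ}
    {x : X} (h : IsDiagMin (FunModConst.mk (maxBusemann c c' C)) x) :
    busemann c x = busemann c' x + C := by
  have h₁ : ∀ y, max (busemann c x) (busemann c' x + C) ≤
    max (busemann c y) (busemann c' y + C) := isDiagMin_mk.1 h
  refine le_antisymm ?_ (hX.busemann_add_le_of_isMin h₁)
  have e : ∀ y, max (busemann c' y) (busemann c y + -C) =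
      max (busemann c y) (busemann c' y + C) - C := fun y => by
    rw [← max_sub_sub_right, max_comm]
    congr 1
    ring
  have h₂ := hX.busemann_add_le_of_isMin (c := c') (c' := c) (C := -C) (x := x) fun y => by
    rw [e, e]
    exact sub_le_sub_right (h₁ y) C
  linarith

theorem IsCATNegOne.mk_maxBusemann_eq [ProperSpace X] (hX : IsCATNegOne X) (c c' : GeodesicRay X) (C : ℝ)
    (o : X) : ∃ (r r' : GeodesicRay X) (D : ℝ), r 0 = o ∧ r' 0 = o ∧
      FunModConst.mk (maxBusemann c c' C) = FunModConst.mk (maxBusemann r r' D) := by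
  obtain ⟨r, hr0, hr⟩ := hX.exists_ray_busemann_eq c o
  obtain ⟨r', hr0', hr'⟩ := hX.exists_ray_busemann_eq c' o
  refine ⟨r, r', busemann c' o + C - busemann c o, hr0, hr0',
    FunModConst.mk_eq_mk.2 ⟨-busemann c o, fun z => ?_⟩⟩
  rw [maxBusemann_apply, maxBusemann_apply, hr, hr', ← max_add_add_right]
  congr 1
  ring

/-! ### Rays from a given point -/

/-- The rays from `o`, with the topology of pointwise convergence. -/
abbrev RayFrom (o : X) : Type _ := {f : NNReal → X // Isometry f ∧ f 0 = o}

/-- A ray from `o` is a ray. -/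
def RayFrom.toRay {o : X} (c : RayFrom o) : GeodesicRay X := ⟨c.1, c.2.1⟩

/-- Tychonoff: the rays from `o` form a closed subset of a product of closed balls. -/
instance rayFromCompactSpace [ProperSpace X] (o : X) : CompactSpace (RayFrom o) := by
  suffices h : IsCompact {f : NNReal → X | Isometry f ∧ f 0 = o} from
    isCompact_iff_compactSpace.1 h
  refine (isCompact_univ_pi fun t : NNReal => isCompact_closedBall o (t : ℝ)).of_isClosed_subset
    ?_ ?_
  · have h : {f : NNReal → X | Isometry f ∧ f 0 = o} =
        (⋂ (s : NNReal) (t : NNReal), {f | dist (f s) (f t) = dist s t}) ∩ {f | f 0 = o} := by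
      ext f
      simp [isometry_iff_dist_eq]
    rw [h]
    refine (isClosed_iInter fun s => isClosed_iInter fun t => ?_).inter ?_
    · exact isClosed_eq ((continuous_apply s).dist (continuous_apply t)) continuous_const
    · exact isClosed_eq (continuous_apply 0) continuous_const
  · rintro f ⟨hf, h0⟩ t -
    rw [Metric.mem_closedBall, ← h0, hf.dist_eq, NNReal.dist_eq]
    simp

/-- The error in `IsCATNegOne.exp_dist_sub_le` depends only on `s` and `dist z o`, so `exp (busemann
c z)` is a uniform limit, over all rays `c` from `o`, of functions continuous in `c`. -/
theorem IsCATNegOne.continuous_busemann_ray (hX : IsCATNegOne X) (o z : X) :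
    Continuous fun c : RayFrom o => busemann c.toRay z := by
  have h : Continuous fun c : RayFrom o => Real.exp (busemann c.toRay z) := by
    have hunif : TendstoUniformly
        (fun (s : NNReal) (c : RayFrom o) => Real.exp (dist z (c.1 s) - s))
        (fun c => Real.exp (busemann c.toRay z)) atTop := by
      rw [Metric.tendstoUniformly_iff]
      intro ε hε
      have h₂ : Tendsto (fun s : NNReal => 2 * Real.exp (-(2 * s)) * Real.cosh (dist z o)) atTop
          (𝓝 (2 * 0 * Real.cosh (dist z o))) := by
        refine (Tendsto.const_mul 2 ?_).mul_const _
        exact Real.tendsto_exp_atBot.comp (tendsto_neg_atTop_atBot.comp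
          ((NNReal.tendsto_coe_atTop.2 tendsto_id).const_mul_atTop two_pos))
      rw [mul_zero, zero_mul] at h₂
      filter_upwards [h₂.eventually_lt_const hε] with s hs c
      have h₃ := hX.exp_dist_sub_le c.toRay z s
      have h₄ := Real.exp_le_exp.2 (busemann_le_dist_sub c.toRay z s)
      have h₅ : c.toRay 0 = o := c.2.2
      rw [h₅] at h₃
      rw [dist_comm, Real.dist_eq]
      show |Real.exp (dist z (c.toRay s) - s) - _| < ε
      rw [abs_of_nonneg (by linarith)]
      linarith
    refine hunif.continuous (Frequently.of_forall fun s => ?_)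
    exact Real.continuous_exp.comp ((continuous_const.dist
      ((continuous_apply s).comp continuous_subtype_val)).sub continuous_const)
  refine (h.log fun c => (Real.exp_pos _).ne').congr fun c => Real.log_exp _

theorem IsCATNegOne.continuous_busemann_uncurry (hX : IsCATNegOne X) (o : X) :
    Continuous fun p : RayFrom o × X => busemann p.1.toRay p.2 := by
  refine continuous_prod_of_continuous_lipschitzWith' _ 1 (fun c => ?_)
    (hX.continuous_busemann_ray o)
  exact LipschitzWith.of_le_add (busemann_le_add_dist c.toRay)

/-! ### Cocompactness -/

theorem IsCATNegOne.isCompact_isDiagMin [ProperSpace X] (hX : IsCATNegOne X) (o : X) (R : ℝ) :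
    IsCompact {η : idealDomain X |
      ∃ x ∈ Metric.closedBall o R, IsDiagMin (η : FunModConst (X × X)) x} := by
  have hβ := hX.continuous_busemann_uncurry o
  let G : RayFrom o × RayFrom o × ℝ × X → X × X → ℝ := fun q z =>
    max (busemann q.1.toRay z.1) (busemann q.2.1.toRay z.2 + q.2.2.1)
  have hG : Continuous fun p : (RayFrom o × RayFrom o × ℝ × X) × (X × X) => G p.1 p.2 := by
    refine Continuous.max ?_ (Continuous.add ?_ (by fun_prop))
    · exact hβ.comp (f := fun p : (RayFrom o × RayFrom o × ℝ × X) × (X × X) => (p.1.1, p.2.1)) (by fun_prop)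
    · exact hβ.comp (f := fun p : (RayFrom o × RayFrom o × ℝ × X) × (X × X) => (p.1.2.1, p.2.2)) (by fun_prop)
  let Φ : RayFrom o × RayFrom o × ℝ × X → C(X × X, ℝ) := fun q => maxBusemann q.1.toRay q.2.1.toRay q.2.2.1
  have hΦ : Continuous Φ := ContinuousMap.continuous_of_continuous_uncurry _ hG
  -- At a minimum the constant is the difference of the two Busemann functions; each vanishes at `o`
  -- and is 1-Lipschitz, hence the bound `2 * R`. Keeping the minimum `x` as a parameter makes
  -- minimality a closed condition.
  let S : Set (RayFrom o × RayFrom o × ℝ × X) := (univ ×ˢ univ ×ˢ Icc (-(2 * R)) (2 * R) ×ˢ Metric.closedBall o R) ∩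
    {q | ∀ y, G q (q.2.2.2, q.2.2.2) ≤ G q (y, y)}
  have hS : IsCompact S := by
    refine IsCompact.inter_right (isCompact_univ.prod (isCompact_univ.prod
      (isCompact_Icc.prod (isCompact_closedBall o R)))) ?_
    rw [Set.ofPred_forall]
    refine isClosed_iInter fun y => isClosed_le ?_ ?_
    · exact hG.comp (f := fun q : RayFrom o × RayFrom o × ℝ × X => (q, (q.2.2.2, q.2.2.2))) (by fun_prop)
    · exact hG.comp (f := fun q : RayFrom o × RayFrom o × ℝ × X => (q, (y, y))) (by fun_prop)
  rw [Subtype.isCompact_iff]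
  convert hS.image ((FunModConst.continuous_mk _).comp hΦ) using 1
  ext η
  constructor
  · rintro ⟨⟨η, _, c, c', C, hne, rfl⟩, ⟨x, hx, hmin⟩, rfl⟩
    obtain ⟨r, r', D, hr, hr', h⟩ := hX.mk_maxBusemann_eq c c' C o
    change IsDiagMin (FunModConst.mk (maxBusemann c c' C)) x at hmin
    rw [h] at hmin
    have heq := hX.busemann_eq_of_isDiagMin hmin
    have h₁ := abs_le.1 (abs_busemann_sub_le r x o)
    have h₂ := abs_le.1 (abs_busemann_sub_le r' x o)
    have h₃ : busemann r o = 0 := by rw [← hr, busemann_apply]; simp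
    have h₄ : busemann r' o = 0 := by rw [← hr', busemann_apply]; simp
    have h₅ := Metric.mem_closedBall.1 hx
    refine ⟨(⟨r.1, r.2, hr⟩, ⟨r'.1, r'.2, hr'⟩, D, x), ⟨?_, ?_⟩, h.symm⟩
    · refine ⟨mem_univ _, mem_univ _, ⟨?_, ?_⟩, hx⟩ <;> simp only <;> linarith
    · exact isDiagMin_mk.1 hmin
  · rintro ⟨q, ⟨⟨-, -, -, hx⟩, hq⟩, rfl⟩
    -- The parameters do not require distinct endpoints; the existence of a minimum implies it.
    refine ⟨⟨_, mk_maxBusemann_mem_idealDomain (C := q.2.2.1)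
      (endpoint_ne_of_le_max (C := q.2.2.1) hq)⟩, ⟨q.2.2.2, hx, isDiagMin_mk.2 hq⟩, rfl⟩

theorem IsCATNegOne.isCocompactAction_idealDomain [ProperSpace X] (hX : IsCATNegOne X)
    (Γ : Subgroup (X ≃ᵢ X)) (hcoc : IsCocompactAction Γ X) :
    IsCocompactAction Γ (idealDomain X) := by
  obtain ⟨K, hK, hKX⟩ := hcoc
  rcases isEmpty_or_nonempty X with hE | ⟨⟨o⟩⟩
  · exact ⟨∅, isCompact_empty, fun η => (hE.false (η.2.2.choose 0)).elim⟩
  obtain ⟨R, hR⟩ := hK.isBounded.subset_closedBall o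
  refine ⟨_, hX.isCompact_isDiagMin o R, fun η => ?_⟩
  obtain ⟨x, hx⟩ := hX.exists_isDiagMin η.2
  obtain ⟨γ, y, hy, rfl⟩ := hKX x
  refine ⟨γ, γ⁻¹ • η, ⟨y, hR hy, ?_⟩, smul_inv_smul γ η⟩
  have h := hx.smul (γ : X ≃ᵢ X)⁻¹
  rwa [Subgroup.smul_def γ y, inv_smul_smul] at h

/-! ### Proper discontinuity -/

/-- By compactness the claim is local. Near `η₀`, a representative `f` is larger on the sphere of
radius `ρ + 1` than at the centre `x₀`. A minimum of `f` beyond the sphere would contradict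
quasi-convexity along the segment from `x₀`. -/
theorem IsCATNegOne.isBounded_isDiagMin [ProperSpace X] (hX : IsCATNegOne X) {K : Set (idealDomain X)}
    (hK : IsCompact K) :
    Bornology.IsBounded {x : X | ∃ η ∈ K, IsDiagMin (η : FunModConst (X × X)) x} := by
  refine hK.induction_on (p := fun s => Bornology.IsBounded
    {x : X | ∃ η ∈ s, IsDiagMin (η : FunModConst (X × X)) x}) ?_ ?_ ?_ ?_
  · simp
  · exact fun s t hst ht => ht.subset fun x ⟨η, hη, h⟩ => ⟨η, hst hη, h⟩
  · refine fun s t hs ht => (hs.union ht).subset ?_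
    rintro x ⟨η, hη | hη, h⟩
    · exact Or.inl ⟨η, hη, h⟩
    · exact Or.inr ⟨η, hη, h⟩
  intro η₀ _
  obtain ⟨x₀, hx₀⟩ := hX.exists_isDiagMin η₀.2
  obtain ⟨-, c, c', C, hne, hη₀⟩ := η₀.2
  set f₀ := maxBusemann c c' C
  set M := f₀ (x₀, x₀) + 1
  obtain ⟨ρ, hρ₀, hρ⟩ : ∃ ρ : ℝ, 0 ≤ ρ ∧ ∀ x, f₀ (x, x) ≤ M → dist x x₀ ≤ ρ := by
    obtain ⟨ρ, hρ⟩ := (hX.isBounded_sublevel hne (max M (M - C))).subset_closedBall x₀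
    refine ⟨max ρ 0, le_max_right _ _, fun x hx => le_max_of_le_left (hρ ?_)⟩
    obtain ⟨h₁, h₂⟩ := max_le_iff.1 (show max (busemann c x) (busemann c' x + C) ≤ _ from hx)
    exact ⟨h₁.trans (le_max_left _ _), le_max_of_le_right (by linarith)⟩
  -- The tolerance `1 / 2` is spent twice, at `x₀` and on the sphere, against the gap `1` in the
  -- definition of `M`.
  set V := {f : C(X × X, ℝ) | ∀ x ∈ Metric.closedBall x₀ (ρ + 1),
    |f (x, x) - f₀ (x, x)| < 1 / 2}
  have hV : V ∈ 𝓝 f₀ := by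
    let Δ : C(X, X × X) := ⟨fun x => (x, x), by fun_prop⟩
    have hcont : Continuous fun f : C(X × X, ℝ) => (f - f₀).comp Δ :=
      (ContinuousMap.continuous_precomp Δ).comp (continuous_id.sub continuous_const)
    have hev := ContinuousMap.eventually_mapsTo (f := (f₀ - f₀).comp Δ)
      (isCompact_closedBall x₀ (ρ + 1)) (Metric.isOpen_ball (x := (0 : ℝ)) (ε := 1 / 2))
      (fun x _ => by simp)
    filter_upwards [hcont.tendsto f₀ hev] with f hf x hx
    simpa [Δ] using hf hx
  refine ⟨Subtype.val ⁻¹' (FunModConst.mk '' V), ?_, ?_⟩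
  -- The quotient map is open, so nearby classes have representatives uniformly close to `f₀` on the
  -- ball.
  · refine mem_nhdsWithin_of_mem_nhds (continuous_subtype_val.continuousAt ?_)
    rw [hη₀]
    exact (FunModConst.isOpenMap_mk _).image_mem_nhds hV
  refine (Metric.isBounded_closedBall (x := x₀) (r := ρ + 1)).subset ?_
  rintro x ⟨⟨η, _, d, d', D, _, hη⟩, ⟨f, hfV, hfη⟩, hx⟩
  change IsDiagMin η x at hx
  change FunModConst.mk f = η at hfη
  rw [← hfη, isDiagMin_mk] at hx
  obtain ⟨a, ha⟩ := FunModConst.mk_eq_mk.1 (hη.symm.trans hfη.symm)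
  by_contra hfar
  rw [Metric.mem_closedBall, not_le, dist_comm] at hfar
  obtain ⟨σ, hσ⟩ := hX.exists_segment x₀ x
  have hs : ρ + 1 ∈ Icc 0 (dist x₀ x) := ⟨by linarith, hfar.le⟩
  have hm : dist (σ (ρ + 1)) x₀ = ρ + 1 := by
    have h := hσ.dist_eq _ hs 0 ⟨le_rfl, dist_nonneg⟩
    rwa [hσ.map_zero, sub_zero, abs_of_nonneg hs.1] at h
  set m := σ (ρ + 1)
  have h₁ : M < f₀ (m, m) := by
    by_contra! h
    linarith [hρ m h]
  have h₂ := abs_lt.1 (hfV m (by rw [Metric.mem_closedBall, hm]))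
  have h₃ := abs_lt.1 (hfV x₀ (Metric.mem_closedBall_self (by linarith)))
  have h₄ : f (m, m) ≤ max (f (x₀, x₀)) (f (x, x)) := by
    rw [ha, ha, ha, max_add_add_right]
    refine add_le_add_left ?_ a
    simp only [maxBusemann_apply]
    refine max_le ?_ ?_
    · exact (hX.busemann_le_max d hσ hs).trans (max_le_max (le_max_left _ _) (le_max_left _ _))
    · refine (add_le_add_left (hX.busemann_le_max d' hσ hs) D).trans ?_
      rw [← max_add_add_right]
      exact max_le_max (le_max_right _ _) (le_max_right _ _)
  rw [max_eq_left (hx x₀)] at h₄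
  linarith [h₂.1, h₃.2]

theorem IsDiscreteSubgroup.exists_eq_one {Γ : Subgroup (X ≃ᵢ X)} (hΓ : IsDiscreteSubgroup Γ) :
    ∃ K : Set X, IsCompact K ∧ ∃ ε > 0, ∀ γ : Γ, (∀ x ∈ K, dist (γ • x) x < ε) → γ = 1 := by
  obtain ⟨U, hU, hU1⟩ := isOpen_induced_iff.1 (@isOpen_discrete Γ (_) hΓ {1})
  have h1 : (ContinuousMap.id X) ∈ U := by
    have : (1 : Γ) ∈ ({1} : Set Γ) := rfl
    rw [← hU1] at this
    exact this
  obtain ⟨⟨K, ε⟩, ⟨hK, hε⟩, hsub⟩ := (nhds_basis_uniformity'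
    Metric.uniformity_basis_dist.compactConvergenceUniformity).mem_iff.1 (hU.mem_nhds h1)
  refine ⟨K, hK, ε, hε, fun γ hγ => ?_⟩
  rw [← mem_singleton_iff, ← hU1]
  refine hsub fun x hx => ?_
  have := hγ x hx
  rw [dist_comm] at this
  exact this

/-- Pigeonhole on finite nets: each such `γ` maps `K` into the ball of radius `3 * R`, so it is
recorded up to `ε / 4` by a map from a net `F` of `K` to a net `J` of that ball. Two elements with
the same record differ by less than `4 * (ε / 4)` on `K`, hence are equal by discreteness. -/
theorem IsDiscreteSubgroup.finite_image_inter_nonempty [ProperSpace X] {Γ : Subgroup (X ≃ᵢ X)}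
    (hΓ : IsDiscreteSubgroup Γ) {A B : Set X} (hA : Bornology.IsBounded A)
    (hB : Bornology.IsBounded B) :
    {γ : Γ | ∃ x ∈ A, γ • x ∈ B}.Finite := by
  obtain ⟨K, hK, ε, hε, hone⟩ := hΓ.exists_eq_one
  rcases A.eq_empty_or_nonempty with rfl | ⟨o, -⟩
  · simp
  obtain ⟨R, hR⟩ := ((hA.union hB).union hK.isBounded).subset_closedBall o
  obtain ⟨F, hFK, hF, hKF⟩ := hK.finite_cover_balls (e := ε / 4) (by positivity)
  obtain ⟨J, -, hJ, hRJ⟩ := (isCompact_closedBall o (3 * R)).finite_cover_balls (e := ε / 4)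
    (by positivity)
  have hj : ∀ (γ : {γ : Γ | ∃ x ∈ A, γ • x ∈ B}) (x : F),
      ∃ j : J, dist (γ.1 • (x : X)) j < ε / 4 := by
    rintro ⟨γ, a, ha, hb⟩ ⟨x, hx⟩
    have h₁ := Metric.mem_closedBall.1 (hR (Or.inl (Or.inl ha)))
    have h₂ := Metric.mem_closedBall.1 (hR (Or.inl (Or.inr hb)))
    have h₃ := Metric.mem_closedBall.1 (hR (Or.inr (hFK hx)))
    have h₄ : γ • x ∈ Metric.closedBall o (3 * R) := by
      rw [Metric.mem_closedBall]
      have e : dist (γ • x) (γ • a) = dist x a := (γ : X ≃ᵢ X).isometry.dist_eq x a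
      linarith [dist_triangle (γ • x) (γ • a) o, dist_triangle_right x a o]
    obtain ⟨j, hjJ, hj⟩ := mem_iUnion₂.1 (hRJ h₄)
    exact ⟨⟨j, hjJ⟩, hj⟩
  choose φ hφ using hj
  have := hF.to_subtype
  have := hJ.to_subtype
  refine Set.finite_coe_iff.1 (Finite.of_injective φ ?_)
  intro γ γ' h
  refine Subtype.ext (inv_mul_eq_one.1 (hone (γ.1⁻¹ * γ'.1) fun x hx => ?_))
  obtain ⟨y, hyF, hy⟩ := mem_iUnion₂.1 (hKF hx)
  rw [Metric.mem_ball] at hy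
  have e : dist ((γ.1⁻¹ * γ'.1) • x) x = dist (γ'.1 • x) (γ.1 • x) := by
    have := (γ.1 : X ≃ᵢ X).isometry.dist_eq ((γ.1⁻¹ * γ'.1) • x) x
    rw [← this]
    show dist (γ.1 • (γ.1⁻¹ * γ'.1) • x) (γ.1 • x) = _
    rw [mul_smul, smul_inv_smul]
  have e₁ : dist (γ.1 • x) (γ.1 • y) = dist x y := (γ.1 : X ≃ᵢ X).isometry.dist_eq x y
  have e₂ : dist (γ'.1 • x) (γ'.1 • y) = dist x y := (γ'.1 : X ≃ᵢ X).isometry.dist_eq x y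
  have h₁ := hφ γ ⟨y, hyF⟩
  have h₂ := hφ γ' ⟨y, hyF⟩
  rw [← h] at h₂
  simp only at h₁ h₂
  rw [e]
  linarith [dist_triangle (γ'.1 • x) (γ'.1 • y) (γ.1 • x),
    dist_triangle (γ'.1 • y) (φ γ ⟨y, hyF⟩ : X) (γ.1 • x),
    dist_triangle_left (φ γ ⟨y, hyF⟩ : X) (γ.1 • x) (γ.1 • y),
    dist_comm (γ.1 • x) (γ.1 • y)]

theorem IsCATNegOne.properlyDiscontinuousSMul_idealDomain [ProperSpace X] (hX : IsCATNegOne X)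
    {Γ : Subgroup (X ≃ᵢ X)} (hΓ : IsDiscreteSubgroup Γ) :
    ProperlyDiscontinuousSMul Γ (idealDomain X) where
  finite_disjoint_inter_image {K L} hK hL := by
    refine (hΓ.finite_image_inter_nonempty (hX.isBounded_isDiagMin hK)
      (hX.isBounded_isDiagMin hL)).subset ?_
    rintro γ ⟨_, ⟨η, hη, rfl⟩, hγη⟩
    obtain ⟨x, hx⟩ := hX.exists_isDiagMin η.2
    -- By equivariance, `γ` carries a minimum of a point of `K` to a minimum of a point of `L`.
    exact ⟨x, ⟨η, hη, hx⟩, γ • η, hγη, hx.smul (γ : X ≃ᵢ X)⟩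

end HorofunctionBoundary

theorem mainTheorem8 {X : Type*} [MetricSpace X] [ProperSpace X] [NoncompactSpace X]
    (hX : IsCATNegOne X) (Γ : Subgroup (X ≃ᵢ X)) (hdisc : IsDiscreteSubgroup Γ)
    (hcoc : IsCocompactAction Γ X) :
    IsCocompactAction Γ (idealDomain X) ∧ ProperlyDiscontinuousSMul Γ (idealDomain X) :=
  ⟨hX.isCocompactAction_idealDomain Γ hcoc, hX.properlyDiscontinuousSMul_idealDomain hdisc⟩
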